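/- (Discrete Hudson's Theorem.) Let $d\ge 1$ be odd, $n\ge 0$, $Q=\mathbb Z_d^n$ and $V=Q\times Q$, with the symplectic form $[(p,q),(p',q')]=p\cdot q'-q\cdot p'\in\mathbb Z_d$. Put $\omega=e^{2\pi i/d}$, $\chi(t)=\omega^t$, and let $2^{-1}$ be the inverse of $2$ in $\mathbb Z_d$. On $L^2(\mathbb Z_d)$, with standard basis $(|y\rangle)_{y\in\mathbb Z_d}$, let $\hat x(s)|y\rangle=|y+s\rangle$, $\hat z(r)|y\rangle=\chi(ry)|y\rangle$ and $w(r,s)=\chi(-2^{-1}rs)\,\hat z(r)\hat x(s)$ for $r,s\in\mathbb Z_d$; on $L^2(\mathbb Z_d^n)$ let $w(p,q)=w(p_1,q_1)\otimes\cdots\otimes w(p_n,q_n)$ for $(p,q)\in V$ (the Weyl operators). For a vector $\psi\in L^2(\mathbb Z_d^n)$ let $\Xi_\psi(b)=d^{-n}\operatorname{tr}\big(w(b)^\dagger|\psi\rangle\langle\psi|\big)$, $b\in V$, be its characteristic function; its Wigner function is the symplectic Fourier transform $$W_\psi(a)=d^{-n}\sum_{b\in V}\overline{\chi([a,b])}\,\Xi_\psi(b),\qquad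 a\in V.$$ A unit vector $\psi$ is a stabilizer state if there are a $\mathbb Z_d$-submodule $M\subseteq V$ with $[m,m']=0$ for all $m,m'\in M$ and $|M|=d^n$, and a $v\in V$, such that $\chi([v,m])\,w(m)\psi=\psi$ for all $m\in M$. Let $\psi\in L^2(\mathbb Z_d^n)$ be a state vector, i.e. $\|\psi\|=1$. Then $W_\psi(a)\ge 0$ for all $a\in V$ if and only if $\psi$ is a stabilizer state. If moreover $\psi(q)\neq 0$ for all $q\in Q$, then $\psi$ is a stabilizer state if and only if there exist a symmetric $n\times n$ matrix $\theta$ over $\mathbb Z_d$, an $x\in\mathbb Z_d^n$ and a constant $c\in\mathbb C\setminus\{0\}$ such that $\psi(q)=c\,\omega^{\,q\theta q+x\cdot q}$ for all $q\in Q$. -/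

import Mathlib

open scoped ComplexOrder Matrix

namespace DiscreteHudson

/-- The configuration space `Q = Z_d^n`. -/
abbrev Config (d n : ℕ) : Type := Fin n → ZMod d

/-- The phase space `V = Q × Q`; a point is a pair `(p, q)` of momentum and position. -/
abbrev Phase (d n : ℕ) : Type := Config d n × Config d n

/-- The Hilbert space `L²(Z_d^n)` with its `ℓ²` norm. -/
abbrev Hilb (d n : ℕ) : Type := EuclideanSpace ℂ (Config d n)

/-- The symplectic inner product `[(p, q), (p', q')] = p q' - q p'` on phase space. -/
def symp {d n : ℕ} (a b : Phase d n) : ZMod d := a.1 ⬝ᵥ b.2 - a.2 ⬝ᵥ b.1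

/-- The single-particle shift operator, `x(q) |y⟩ = |y + q⟩`, in the standard basis. -/
def shift {d : ℕ} (q : ZMod d) : Matrix (ZMod d) (ZMod d) ℂ :=
  Matrix.of fun x y => if x = y + q then 1 else 0

section

variable {d n : ℕ} [NeZero d]

/-- The character `χ(t) = exp(2πi t / d)` of `Z_d`. -/
noncomputable def chi (t : ZMod d) : ℂ := ZMod.stdAddChar t

/-- The single-particle boost operator, `z(p) |x⟩ = χ(p x) |x⟩`. -/
noncomputable def boost (p : ZMod d) : Matrix (ZMod d) (ZMod d) ℂ :=
  Matrix.diagonal fun x => chi (p * x)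

/-- The single-particle Weyl operator `w(p, q) = χ(-2⁻¹ p q) z(p) x(q)`.
For odd `d`, `2⁻¹` is the inverse of the unit `2` of `Z_d`. -/
noncomputable def weylOne (p q : ZMod d) : Matrix (ZMod d) (ZMod d) ℂ :=
  chi (-((2 : ZMod d)⁻¹ * p * q)) • (boost p * shift q)

/-- The Weyl operator `w(p, q) = w(p₁, q₁) ⊗ ⋯ ⊗ w(pₙ, qₙ)` in the standard (product) basis. -/
noncomputable def weyl (v : Phase d n) : Matrix (Config d n) (Config d n) ℂ :=
  Matrix.of fun x y => ∏ i, weylOne (v.1 i) (v.2 i) (x i) (y i)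

/-- The characteristic function `Ξ_ρ(b) = d⁻ⁿ tr(w(b)† ρ)` of an operator `ρ`. -/
noncomputable def charFn (ρ : Matrix (Config d n) (Config d n) ℂ) (b : Phase d n) : ℂ :=
  ((d : ℂ) ^ n)⁻¹ * ((weyl b)ᴴ * ρ).trace

/-- The symplectic Fourier transform
`(F_S f)(a) = |V|^(-1/2) ∑_b conj(χ([a, b])) f(b)`, where `|V|^(1/2) = dⁿ`. -/
noncomputable def sympFourier (f : Phase d n → ℂ) (a : Phase d n) : ℂ :=
  ((d : ℂ) ^ n)⁻¹ * ∑ b, star (chi (symp a b)) * f b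

/-- The Wigner function of an operator: the symplectic Fourier transform of its
characteristic function. -/
noncomputable def wigner (ρ : Matrix (Config d n) (Config d n) ℂ) : Phase d n → ℂ :=
  sympFourier (charFn ρ)

/-- The operator `|ψ⟩⟨ψ|`. -/
def pureState (ψ : Hilb d n) : Matrix (Config d n) (Config d n) ℂ :=
  Matrix.vecMulVec ψ (star ⇑ψ)

/-- A subspace (`Z_d`-submodule) of phase space is maximally isotropic if the symplectic inner
product vanishes on it and it has `dⁿ` elements. -/
def IsMaxIsotropic (M : Submodule (ZMod d) (Phase d n)) : Prop :=
  (∀ a ∈ M, ∀ b ∈ M, symp a b = 0) ∧ Nat.card M = d ^ n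

/-- `ψ` is a stabilizer state: a unit vector for which there are a maximally isotropic `M` and a
`v ∈ V` with `χ([v, m]) w(m) ψ = ψ` for all `m ∈ M`. -/
def IsStabilizerState (ψ : Hilb d n) : Prop :=
  ‖ψ‖ = 1 ∧ ∃ (M : Submodule (ZMod d) (Phase d n)) (v : Phase d n), IsMaxIsotropic M ∧
    ∀ m ∈ M, chi (symp v m) • (weyl m *ᵥ ⇑ψ) = ⇑ψ

end

end DiscreteHudson

namespace DiscreteHudson

theorem two_mul_half {d : ℕ} (hd : Odd d) : (2 : ZMod d) * 2⁻¹ = 1 := by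
  have := ZMod.coe_mul_inv_eq_one (n := d) 2 (Nat.coprime_two_left.2 hd)
  simpa using this

section

variable {d n : ℕ}

theorem add_self_half (hd : Odd d) {E : Type*} [AddCommGroup E] [Module (ZMod d) E] (x : E) :
    (2 : ZMod d)⁻¹ • (x + x) = x := by
  rw [← two_smul (ZMod d) x, smul_smul, mul_comm, two_mul_half hd, one_smul]

theorem half_add_half (hd : Odd d) {E : Type*} [AddCommGroup E] [Module (ZMod d) E] (x : E) :
    (2 : ZMod d)⁻¹ • x + (2 : ZMod d)⁻¹ • x = x := by
  rw [← smul_add, add_self_half hd]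

theorem symp_swap (a b : Phase d n) : symp b a = -symp a b := by
  rw [symp, symp, dotProduct_comm b.1, dotProduct_comm b.2, neg_sub]

theorem symp_add_right (a b c : Phase d n) : symp a (b + c) = symp a b + symp a c := by
  simp only [symp, Prod.fst_add, Prod.snd_add, dotProduct_add]; ring

theorem symp_add_left (a b c : Phase d n) : symp (a + b) c = symp a c + symp b c := by
  simp only [symp, Prod.fst_add, Prod.snd_add, add_dotProduct]; ring

theorem dotProduct_mulVec_comm {θ : Matrix (Fin n) (Fin n) (ZMod d)} (hθ : θ.IsSymm)
    (p q : Config d n) : p ⬝ᵥ θ *ᵥ q = q ⬝ᵥ θ *ᵥ p := by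
  rw [Matrix.dotProduct_mulVec, ← Matrix.mulVec_transpose, hθ.eq, dotProduct_comm]

end

section

variable {d n : ℕ} [NeZero d]

theorem chi_add (s t : ZMod d) : chi (s + t) = chi s * chi t :=
  AddChar.map_add_eq_mul _ _ _

@[simp]
theorem chi_zero : chi (0 : ZMod d) = 1 :=
  AddChar.map_zero_eq_one _

theorem norm_chi (t : ZMod d) : ‖chi t‖ = 1 :=
  AddChar.norm_apply _ _

theorem chi_mul_chi_neg (t : ZMod d) : chi t * chi (-t) = 1 := by
  rw [← chi_add, add_neg_cancel, chi_zero]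

theorem star_chi (t : ZMod d) : star (chi t) = chi (-t) :=
  (AddChar.map_neg_eq_conj _ t).symm

theorem chi_ne_zero (t : ZMod d) : chi t ≠ 0 := by
  rw [← norm_ne_zero_iff, norm_chi]; exact one_ne_zero

theorem chi_eq_one_iff {t : ZMod d} : chi t = 1 ↔ t = 0 :=
  ⟨fun h => ZMod.injective_stdAddChar (by rw [AddChar.map_zero_eq_one]; exact h),
    fun h => by rw [h, chi_zero]⟩

theorem chi_sum {ι : Type*} (s : Finset ι) (f : ι → ZMod d) :
    chi (∑ i ∈ s, f i) = ∏ i ∈ s, chi (f i) := by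
  classical
  induction s using Finset.induction_on with
  | empty => simp
  | insert a s ha ih => rw [Finset.sum_insert ha, Finset.prod_insert ha, chi_add, ih]

/-- A character of a finite group of the form `χ ∘ φ` sums to zero unless `φ` vanishes. -/
theorem sum_chi_hom {G : Type*} [AddCommGroup G] [Fintype G] (φ : G →+ ZMod d) :
    ∑ g, chi (φ g) = (if ∀ g, φ g = 0 then (Fintype.card G : ℂ) else 0) := by
  classical
  have h := AddChar.sum_eq_ite ((ZMod.stdAddChar (N := d)).compAddMonoidHom φ)
  have e : ((ZMod.stdAddChar (N := d)).compAddMonoidHom φ = 0) ↔ ∀ g, φ g = 0 := by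
    constructor
    · intro h g
      apply chi_eq_one_iff.1
      exact DFunLike.congr_fun h g
    · intro h
      ext g
      change chi (φ g) = 1
      rw [h g, chi_zero]
  simp only [e] at h
  exact h

theorem sum_chi_dotProduct (y : Config d n) :
    ∑ p : Config d n, chi (p ⬝ᵥ y) = if y = 0 then (d : ℂ) ^ n else 0 := by
  have h := sum_chi_hom (d := d)
    (⟨⟨fun p : Config d n => p ⬝ᵥ y, zero_dotProduct y⟩, fun p q => add_dotProduct p q y⟩)
  have e : (∀ p : Config d n, p ⬝ᵥ y = 0) ↔ y = 0 := by
    constructor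
    · intro h
      funext i
      simpa using h (Pi.single i 1)
    · rintro rfl p
      exact dotProduct_zero p
  simpa [e, ZMod.card] using h

/-- Plancherel's identity on `Z_d^n`. -/
theorem sum_norm_fourier_sq (g : Config d n → ℂ) :
    ∑ p : Config d n, ‖∑ x, chi (-(p ⬝ᵥ x)) * g x‖ ^ 2 = (d : ℝ) ^ n * ∑ x, ‖g x‖ ^ 2 := by
  have key : ∀ p : Config d n, ((‖∑ x, chi (-(p ⬝ᵥ x)) * g x‖ ^ 2 : ℝ) : ℂ) =
      ∑ x, ∑ y, chi (p ⬝ᵥ (y - x)) * (g x * star (g y)) := by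
    intro p
    rw [Complex.ofReal_pow, ← Complex.mul_conj', ← Complex.star_def, star_sum, Finset.sum_mul_sum]
    refine Finset.sum_congr rfl fun x _ => Finset.sum_congr rfl fun y _ => ?_
    rw [star_mul', star_chi, dotProduct_sub, sub_eq_add_neg, chi_add, neg_neg]
    ring
  apply Complex.ofReal_injective
  rw [Complex.ofReal_sum]
  simp_rw [key]
  rw [Finset.sum_comm]
  push_cast
  rw [Finset.mul_sum]
  refine Finset.sum_congr rfl fun x _ => ?_
  rw [Finset.sum_comm]
  simp_rw [← Finset.sum_mul, sum_chi_dotProduct, sub_eq_zero]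
  simp [← Complex.mul_conj']

/-- The action of the Weyl operator `w(v)` on functions. -/
noncomputable def weylAct (v : Phase d n) (f : Config d n → ℂ) (x : Config d n) : ℂ :=
  chi (v.1 ⬝ᵥ x - 2⁻¹ * (v.1 ⬝ᵥ v.2)) * f (x - v.2)

/-- The phase space point operator at `a`, i.e. the reflection about `a`, on functions. -/
noncomputable def parity (a : Phase d n) (f : Config d n → ℂ) (x : Config d n) : ℂ :=
  chi (2 * (a.1 ⬝ᵥ x - a.1 ⬝ᵥ a.2)) * f (a.2 + a.2 - x)

theorem weyl_apply (v : Phase d n) (x y : Config d n) :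
    weyl v x y = if x = y + v.2 then chi (v.1 ⬝ᵥ x - 2⁻¹ * (v.1 ⬝ᵥ v.2)) else 0 := by
  have h : ∀ i, weylOne (v.1 i) (v.2 i) (x i) (y i) =
      if x i = y i + v.2 i then chi (v.1 i * x i - 2⁻¹ * (v.1 i * v.2 i)) else 0 := by
    intro i
    simp only [weylOne, boost, shift, Matrix.smul_apply, Matrix.diagonal_mul, Matrix.of_apply,
      smul_eq_mul, mul_ite, mul_one, mul_zero, ← chi_add]
    congr 2
    ring
  simp only [weyl, Matrix.of_apply, h]
  rw [Finset.prod_ite_zero]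
  simp only [Finset.mem_univ, true_imp_iff, ← chi_sum, funext_iff, Pi.add_apply, dotProduct,
    Finset.sum_sub_distrib, Finset.mul_sum]

theorem weyl_mulVec (v : Phase d n) (f : Config d n → ℂ) : weyl v *ᵥ f = weylAct v f := by
  funext x
  simp only [Matrix.mulVec, dotProduct, weyl_apply, weylAct, ite_mul, zero_mul]
  rw [Finset.sum_eq_single (x - v.2)]
  · simp
  · intro y _ hy
    rw [if_neg]
    rintro rfl
    simp at hy
  · simp

theorem charFn_eq (ψ : Hilb d n) (b : Phase d n) :
    charFn (pureState ψ) b = ((d : ℂ) ^ n)⁻¹ * ∑ x, ψ x * star (weylAct b ψ x) := by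
  rw [charFn, ← weyl_mulVec]
  congr 1
  simp only [Matrix.trace, Matrix.diag, Matrix.mul_apply, pureState, Matrix.vecMulVec_apply,
    Matrix.conjTranspose_apply, Matrix.mulVec, dotProduct, star_sum, Finset.mul_sum, Pi.star_apply,
    star_mul']
  rw [Finset.sum_comm]
  refine Finset.sum_congr rfl fun x _ => Finset.sum_congr rfl fun y _ => ?_
  ring

theorem wigner_eq (hd : Odd d) (ψ : Hilb d n) (a : Phase d n) :
    wigner (pureState ψ) a = ((d : ℂ) ^ n)⁻¹ * ∑ x, ψ x * star (parity a ψ x) := by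
  have h2 := two_mul_half hd
  have hdn : (d : ℂ) ^ n ≠ 0 := pow_ne_zero _ (Nat.cast_ne_zero.2 (NeZero.ne d))
  rw [wigner, sympFourier]
  congr 1
  simp_rw [charFn_eq, Finset.mul_sum]
  rw [Finset.sum_comm]
  refine Finset.sum_congr rfl fun x _ => ?_
  rw [Fintype.sum_prod_type, Finset.sum_comm]
  have key : ∀ s r : Config d n, star (chi (symp a (r, s))) *
      (((d : ℂ) ^ n)⁻¹ * (ψ x * star (weylAct (r, s) ψ x))) =
      chi (r ⬝ᵥ (a.2 + (2 : ZMod d)⁻¹ • s - x)) *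
        (((d : ℂ) ^ n)⁻¹ * ψ x * chi (-(a.1 ⬝ᵥ s)) * star (ψ (x - s))) := by
    intro s r
    have e : -(symp a (r, s)) + -(r ⬝ᵥ x - 2⁻¹ * (r ⬝ᵥ s)) =
        r ⬝ᵥ (a.2 + (2 : ZMod d)⁻¹ • s - x) + -(a.1 ⬝ᵥ s) := by
      simp only [symp, dotProduct_sub, dotProduct_add, dotProduct_smul, smul_eq_mul]
      rw [dotProduct_comm a.2 r]
      ring
    have e' := congrArg chi e
    rw [chi_add, chi_add _ (-(a.1 ⬝ᵥ s))] at e'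
    rw [weylAct, star_mul', star_chi, star_chi]
    linear_combination (((d : ℂ) ^ n)⁻¹ * ψ x * star (ψ (x - s))) * e'
  simp_rw [key, ← Finset.sum_mul, sum_chi_dotProduct]
  have hs : ∀ s : Config d n, a.2 + (2 : ZMod d)⁻¹ • s - x = 0 ↔ s = (x - a.2) + (x - a.2) := by
    intro s
    constructor
    · intro h
      have : (2 : ZMod d)⁻¹ • s = x - a.2 := by rw [← sub_eq_zero, ← h]; abel
      rw [← this, half_add_half hd]
    · rintro rfl
      rw [add_self_half hd]; abel
  simp_rw [hs, ite_mul, zero_mul]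
  rw [Finset.sum_ite_eq' , if_pos (Finset.mem_univ _)]
  rw [parity, star_mul', star_chi]
  have e1 : x - (x - a.2 + (x - a.2)) = a.2 + a.2 - x := by abel
  have e2 : -(a.1 ⬝ᵥ (x - a.2 + (x - a.2))) = -(2 * (a.1 ⬝ᵥ x - a.1 ⬝ᵥ a.2)) := by
    simp only [dotProduct_sub, dotProduct_add]; ring
  rw [e1, e2]
  field_simp

theorem weylAct_weylAct (hd : Odd d) (a b : Phase d n) (f : Config d n → ℂ) :
    weylAct a (weylAct b f) = chi (2⁻¹ * symp a b) • weylAct (a + b) f := by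
  have h2 := two_mul_half hd
  funext x
  simp only [weylAct, Pi.smul_apply, smul_eq_mul, ← mul_assoc, ← chi_add]
  congr 2
  · simp only [symp, Prod.fst_add, Prod.snd_add, dotProduct_add, add_dotProduct, dotProduct_sub]
    rw [dotProduct_comm a.2 b.1]
    linear_combination (b.1 ⬝ᵥ a.2) * h2
  · simp only [Prod.snd_add]; abel

theorem parity_add_half (hd : Odd d) (v m : Phase d n) (f : Config d n → ℂ) :
    parity (v + (2 : ZMod d)⁻¹ • m) f = chi (symp v m) • weylAct m (parity v f) := by
  have h2 := two_mul_half hd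
  funext x
  simp only [weylAct, parity, Pi.smul_apply, smul_eq_mul, ← mul_assoc, ← chi_add]
  congr 2
  · simp only [symp, Prod.fst_add, Prod.snd_add, dotProduct_add, add_dotProduct, dotProduct_sub,
      Prod.smul_fst, Prod.smul_snd, dotProduct_smul, smul_dotProduct, smul_eq_mul]
    rw [dotProduct_comm v.2 m.1]
    linear_combination (m.1 ⬝ᵥ x - v.1 ⬝ᵥ m.2 - m.1 ⬝ᵥ v.2 - 2⁻¹ * (m.1 ⬝ᵥ m.2)) * h2
  · have := half_add_half hd m.2
    simp only [Prod.snd_add, Prod.smul_snd]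
    nth_rewrite 3 [← this]
    abel

theorem weylAct_zero (f : Config d n → ℂ) : weylAct 0 f = f := by
  funext x
  simp [weylAct]

theorem weylAct_smul (a : Phase d n) (c : ℂ) (f : Config d n → ℂ) :
    weylAct a (c • f) = c • weylAct a f := by
  funext x
  simp only [weylAct, Pi.smul_apply, smul_eq_mul]; ring

theorem sum_norm_parity_sq (a : Phase d n) (f : Config d n → ℂ) :
    ∑ x, ‖parity a f x‖ ^ 2 = ∑ x, ‖f x‖ ^ 2 := by
  simp only [parity, norm_mul, norm_chi, one_mul]
  exact (Equiv.subLeft (a.2 + a.2)).sum_comp fun x => ‖f x‖ ^ 2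

theorem sum_norm_sub_sq {ι : Type*} [Fintype ι] (f g : ι → ℂ) :
    ∑ x, ‖g x - f x‖ ^ 2 =
      ∑ x, ‖g x‖ ^ 2 + ∑ x, ‖f x‖ ^ 2 - 2 * (∑ x, f x * star (g x)).re := by
  rw [Complex.re_sum, Finset.mul_sum, ← Finset.sum_add_distrib, ← Finset.sum_sub_distrib]
  refine Finset.sum_congr rfl fun x _ => ?_
  simp only [← Complex.normSq_eq_norm_sq, Complex.normSq_apply, Complex.sub_re, Complex.sub_im,
    Complex.mul_re, Complex.star_def, Complex.conj_re, Complex.conj_im]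
  ring

theorem sum_norm_sq (ψ : Hilb d n) (hψ : ‖ψ‖ = 1) : ∑ x, ‖ψ x‖ ^ 2 = 1 := by
  rw [← EuclideanSpace.norm_sq_eq, hψ, one_pow]

theorem natCast_pow_ne_zero : (d : ℂ) ^ n ≠ 0 :=
  pow_ne_zero _ (Nat.cast_ne_zero.2 (NeZero.ne d))

theorem natCast_pow_pos : (0 : ℝ) < (d : ℝ) ^ n :=
  pow_pos (Nat.cast_pos.2 (NeZero.pos d)) _

/-- The purity of a pure state in terms of its characteristic function. -/
theorem sum_norm_charFn_sq (ψ : Hilb d n) (hψ : ‖ψ‖ = 1) :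
    ∑ b, ‖charFn (pureState ψ) b‖ ^ 2 = ((d : ℝ) ^ n)⁻¹ := by
  have key : ∀ p q : Config d n, ‖charFn (pureState ψ) (p, q)‖ ^ 2 =
      ((d : ℝ) ^ n)⁻¹ ^ 2 * ‖∑ x, chi (-(p ⬝ᵥ x)) * (ψ x * star (ψ (x - q)))‖ ^ 2 := by
    intro p q
    have : ∑ x, ψ x * star (weylAct (p, q) ψ x) =
        chi (2⁻¹ * (p ⬝ᵥ q)) * ∑ x, chi (-(p ⬝ᵥ x)) * (ψ x * star (ψ (x - q))) := by
      rw [Finset.mul_sum]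
      refine Finset.sum_congr rfl fun x _ => ?_
      rw [weylAct, star_mul', star_chi, neg_sub, sub_eq_add_neg, chi_add]
      ring
    rw [charFn_eq, this, norm_mul, norm_mul, norm_chi, one_mul, mul_pow]
    simp
  rw [Fintype.sum_prod_type, Finset.sum_comm]
  simp_rw [key, ← Finset.mul_sum, sum_norm_fourier_sq, norm_mul, mul_pow, norm_star]
  rw [← Finset.mul_sum, Finset.sum_comm]
  simp_rw [← Finset.mul_sum]
  have : ∀ x : Config d n, ∑ q, ‖ψ (x - q)‖ ^ 2 = 1 := fun x => by
    rw [← sum_norm_sq ψ hψ]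
    exact (Equiv.subLeft x).sum_comp fun y => ‖ψ y‖ ^ 2
  simp_rw [this, mul_one, sum_norm_sq ψ hψ]
  have := (natCast_pow_pos (d := d) (n := n)).ne'
  field_simp

/-- Moyal's identity for a pure state. -/
theorem sum_norm_wigner_sq (hd : Odd d) (ψ : Hilb d n) (hψ : ‖ψ‖ = 1) :
    ∑ a, ‖wigner (pureState ψ) a‖ ^ 2 = ((d : ℝ) ^ n)⁻¹ := by
  have key : ∀ p q : Config d n, ‖wigner (pureState ψ) (p, q)‖ ^ 2 =
      ((d : ℝ) ^ n)⁻¹ ^ 2 * ‖∑ x, chi (-((p + p) ⬝ᵥ x)) * (ψ x * star (ψ (q + q - x)))‖ ^ 2 := by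
    intro p q
    have : ∑ x, ψ x * star (parity (p, q) ψ x) =
        chi (2 * (p ⬝ᵥ q)) * ∑ x, chi (-((p + p) ⬝ᵥ x)) * (ψ x * star (ψ (q + q - x))) := by
      rw [Finset.mul_sum]
      refine Finset.sum_congr rfl fun x _ => ?_
      have e : -(2 * (p ⬝ᵥ x - p ⬝ᵥ q)) = 2 * (p ⬝ᵥ q) + -((p + p) ⬝ᵥ x) := by
        rw [add_dotProduct]; ring
      rw [parity, star_mul', star_chi, e, chi_add]
      ring
    rw [wigner_eq hd, this, norm_mul, norm_mul, norm_chi, one_mul, mul_pow]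
    simp
  have hdouble : Function.Bijective fun p : Config d n => p + p :=
    (Finite.injective_iff_bijective).1 fun p q h => by
      rw [← add_self_half hd p, ← add_self_half hd q]; exact congrArg _ h
  have hp : ∀ q : Config d n,
      ∑ p : Config d n, ‖∑ x, chi (-((p + p) ⬝ᵥ x)) * (ψ x * star (ψ (q + q - x)))‖ ^ 2 =
      (d : ℝ) ^ n * ∑ x, ‖ψ x * star (ψ (q + q - x))‖ ^ 2 := fun q => by
    rw [← sum_norm_fourier_sq]
    exact hdouble.sum_comp fun p => ‖∑ x, chi (-(p ⬝ᵥ x)) * (ψ x * star (ψ (q + q - x)))‖ ^ 2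
  rw [Fintype.sum_prod_type, Finset.sum_comm]
  simp_rw [key, ← Finset.mul_sum, hp, norm_mul, mul_pow, norm_star]
  rw [← Finset.mul_sum, Finset.sum_comm]
  simp_rw [← Finset.mul_sum]
  have : ∀ x : Config d n, ∑ q, ‖ψ (q + q - x)‖ ^ 2 = 1 := fun x => by
    rw [← sum_norm_sq ψ hψ]
    rw [← (Equiv.subRight x).sum_comp fun y => ‖ψ y‖ ^ 2]
    exact hdouble.sum_comp fun y => ‖ψ (y - x)‖ ^ 2
  simp_rw [this, mul_one, sum_norm_sq ψ hψ]
  have := (natCast_pow_pos (d := d) (n := n)).ne'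
  field_simp

theorem sum_wigner (hd : Odd d) (ψ : Hilb d n) (hψ : ‖ψ‖ = 1) :
    ∑ a, wigner (pureState ψ) a = 1 := by
  simp_rw [wigner_eq hd]
  rw [← Finset.mul_sum, Finset.sum_comm]
  have key : ∀ x : Config d n, ∑ a, ψ x * star (parity a ψ x) =
      (d : ℂ) ^ n * ((‖ψ x‖ ^ 2 : ℝ) : ℂ) := by
    intro x
    rw [Fintype.sum_prod_type, Finset.sum_comm]
    have e : ∀ p q : Config d n, ψ x * star (parity (p, q) ψ x) =
        chi (p ⬝ᵥ ((q + q) - (x + x))) * (ψ x * star (ψ (q + q - x))) := by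
      intro p q
      have : -(2 * (p ⬝ᵥ x - p ⬝ᵥ q)) = p ⬝ᵥ ((q + q) - (x + x)) := by
        simp only [dotProduct_sub, dotProduct_add]; ring
      rw [parity, star_mul', star_chi, this]
      ring
    have hx : ∀ q : Config d n, (q + q) - (x + x) = 0 ↔ q = x := by
      intro q
      rw [sub_eq_zero]
      refine ⟨fun h => ?_, fun h => by rw [h]⟩
      rw [← add_self_half hd q, h, add_self_half hd]
    simp_rw [e, ← Finset.sum_mul, sum_chi_dotProduct, hx, ite_mul, zero_mul]
    rw [Finset.sum_ite_eq', if_pos (Finset.mem_univ _), add_sub_cancel_right, Complex.star_def,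
      Complex.mul_conj']
    push_cast
    rfl
  simp_rw [key]
  rw [← Finset.mul_sum, ← Complex.ofReal_sum, sum_norm_sq ψ hψ, Complex.ofReal_one, mul_one,
    inv_mul_cancel₀ natCast_pow_ne_zero]

theorem sum_norm_parity_sub_sq (hd : Odd d) (ψ : Hilb d n) (hψ : ‖ψ‖ = 1) (a : Phase d n) :
    ∑ x, ‖parity a ψ x - ψ x‖ ^ 2 =
      2 * (1 - (d : ℝ) ^ n * (wigner (pureState ψ) a).re) := by
  have h : ∑ x, ψ x * star (parity a ψ x) = (((d : ℝ) ^ n : ℝ) : ℂ) * wigner (pureState ψ) a := by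
    rw [wigner_eq hd]
    push_cast
    rw [mul_inv_cancel_left₀ natCast_pow_ne_zero]
  rw [sum_norm_sub_sq, sum_norm_parity_sq, sum_norm_sq ψ hψ, h, Complex.re_ofReal_mul]
  ring

theorem parity_eq_self_iff (hd : Odd d) (ψ : Hilb d n) (hψ : ‖ψ‖ = 1) (a : Phase d n) :
    parity a ψ = ψ ↔ (wigner (pureState ψ) a).re = ((d : ℝ) ^ n)⁻¹ := by
  have h := sum_norm_parity_sub_sq hd ψ hψ a
  have hpos := natCast_pow_pos (d := d) (n := n)
  constructor
  · intro e
    rw [e] at h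
    simp only [sub_self, norm_zero] at h
    apply eq_inv_of_mul_eq_one_right
    simp at h
    linarith
  · intro e
    rw [e, mul_inv_cancel₀ hpos.ne', sub_self, mul_zero,
      Finset.sum_eq_zero_iff_of_nonneg fun _ _ => sq_nonneg _] at h
    funext x
    have := h x (Finset.mem_univ x)
    rwa [sq_eq_zero_iff, norm_eq_zero, sub_eq_zero] at this

/-- A pure state with non-negative Wigner function is fixed by exactly `d ^ n` reflections. -/
theorem card_parity_eq_self (hd : Odd d) (ψ : Hilb d n) (hψ : ‖ψ‖ = 1)
    (hW : ∀ a, 0 ≤ wigner (pureState ψ) a) :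
    Nat.card {a : Phase d n // parity a ψ = ψ} = d ^ n := by
  classical
  have hpos := natCast_pow_pos (d := d) (n := n)
  set W : Phase d n → ℝ := fun a => (wigner (pureState ψ) a).re with hWdef
  have hof : ∀ a, wigner (pureState ψ) a = (W a : ℂ) := fun a =>
    Complex.ext rfl (Complex.nonneg_iff.1 (hW a)).2.symm
  have h0 : ∀ a, 0 ≤ W a := fun a => (Complex.nonneg_iff.1 (hW a)).1
  have h1 : ∀ a, 0 ≤ 1 - (d : ℝ) ^ n * W a := fun a => by
    have h := sum_norm_parity_sub_sq hd ψ hψ a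
    have : 0 ≤ ∑ x, ‖parity a ψ x - ψ x‖ ^ 2 := Finset.sum_nonneg fun _ _ => sq_nonneg _
    linarith
  have hsum : ∑ a, W a = 1 := by
    have := sum_wigner hd ψ hψ
    simp_rw [hof] at this
    exact_mod_cast this
  have hsq : ∑ a, W a ^ 2 = ((d : ℝ) ^ n)⁻¹ := by
    rw [← sum_norm_wigner_sq hd ψ hψ]
    refine Finset.sum_congr rfl fun a _ => ?_
    rw [hof, Complex.norm_real, Real.norm_eq_abs, sq_abs]
  have hz : ∑ a, W a * (1 - (d : ℝ) ^ n * W a) = 0 := by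
    have : ∀ a, W a * (1 - (d : ℝ) ^ n * W a) = W a - (d : ℝ) ^ n * W a ^ 2 := fun a => by ring
    simp_rw [this]
    rw [Finset.sum_sub_distrib, ← Finset.mul_sum, hsum, hsq, mul_inv_cancel₀ hpos.ne', sub_self]
  rw [Finset.sum_eq_zero_iff_of_nonneg fun a _ => mul_nonneg (h0 a) (h1 a)] at hz
  have hval : ∀ a, W a = if parity a ψ = ψ then ((d : ℝ) ^ n)⁻¹ else 0 := by
    intro a
    split_ifs with h
    · exact (parity_eq_self_iff hd ψ hψ a).1 h
    · rcases mul_eq_zero.1 (hz a (Finset.mem_univ a)) with h' | h'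
      · exact h'
      · refine absurd ((parity_eq_self_iff hd ψ hψ a).2 ?_) h
        apply eq_inv_of_mul_eq_one_right
        linarith
  simp_rw [hval] at hsum
  rw [← Finset.sum_filter, Finset.sum_const, nsmul_eq_mul, ← div_eq_mul_inv,
    div_eq_one_iff_eq hpos.ne'] at hsum
  rw [Nat.card_eq_fintype_card, Fintype.card_subtype]
  exact_mod_cast hsum

theorem weylAct_eq_of_fixed {v m : Phase d n} {f : Config d n → ℂ}
    (h : chi (symp v m) • weylAct m f = f) : weylAct m f = chi (-symp v m) • f := by
  nth_rewrite 2 [← h]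
  rw [smul_smul, mul_comm, chi_mul_chi_neg, one_smul]

theorem fixed_of_weylAct_eq {v m : Phase d n} {f : Config d n → ℂ}
    (h : weylAct m f = chi (-symp v m) • f) : chi (symp v m) • weylAct m f = f := by
  rw [h, smul_smul, chi_mul_chi_neg, one_smul]

theorem weylAct_add_of_fixed (hd : Odd d) {v a b : Phase d n} {f : Config d n → ℂ}
    (ha : chi (symp v a) • weylAct a f = f) (hb : chi (symp v b) • weylAct b f = f) :
    chi (2⁻¹ * symp a b) • weylAct (a + b) f = chi (-symp v (a + b)) • f := by
  rw [← weylAct_weylAct hd, weylAct_eq_of_fixed hb, weylAct_smul, weylAct_eq_of_fixed ha,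
    smul_smul, ← chi_add, symp_add_right]
  congr 2
  ring

/-- Weyl operators with a common eigenvector commute. -/
theorem symp_eq_zero_of_fixed (hd : Odd d) {v a b : Phase d n} {f : Config d n → ℂ} (hf : f ≠ 0)
    (ha : chi (symp v a) • weylAct a f = f) (hb : chi (symp v b) • weylAct b f = f) :
    symp a b = 0 := by
  have h2 := two_mul_half hd
  have h := weylAct_add_of_fixed hd ha hb
  have h' := weylAct_add_of_fixed hd hb ha
  rw [add_comm b a, symp_swap a b, ← h] at h'
  have hne : weylAct (a + b) f ≠ 0 := by
    intro h0
    rw [h0, smul_zero] at h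
    exact smul_ne_zero (chi_ne_zero _) hf h.symm
  have e : (2 : ZMod d)⁻¹ * -symp a b = 2⁻¹ * symp a b :=
    ZMod.injective_stdAddChar (smul_left_injective ℂ hne h')
  linear_combination -e - symp a b * h2

/-- The phase space points `m` whose Weyl operator fixes `f` up to the phase `χ([v, m])`. -/
def fixedSubmodule (hd : Odd d) (v : Phase d n) (f : Config d n → ℂ) (hf : f ≠ 0) :
    Submodule (ZMod d) (Phase d n) :=
  have hadd : ∀ {a b : Phase d n}, chi (symp v a) • weylAct a f = f →
      chi (symp v b) • weylAct b f = f → chi (symp v (a + b)) • weylAct (a + b) f = f := by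
    intro a b ha hb
    have h := weylAct_add_of_fixed hd ha hb
    rw [symp_eq_zero_of_fixed hd hf ha hb, mul_zero, chi_zero, one_smul] at h
    exact fixed_of_weylAct_eq h
  have hzero : chi (symp v 0) • weylAct 0 f = f := by simp [weylAct_zero, symp]
  { carrier := {m | chi (symp v m) • weylAct m f = f}
    add_mem' := hadd
    zero_mem' := hzero
    smul_mem' := by
      intro c m hm
      rw [Set.mem_ofPred_eq, ← ZMod.natCast_zmod_val c, Nat.cast_smul_eq_nsmul]
      induction c.val with
      | zero => rwa [zero_smul]
      | succ k ih => rw [succ_nsmul]; exact hadd ih hm }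

theorem mem_fixedSubmodule {hd : Odd d} {v : Phase d n} {f : Config d n → ℂ} {hf : f ≠ 0}
    {m : Phase d n} : m ∈ fixedSubmodule hd v f hf ↔ chi (symp v m) • weylAct m f = f :=
  Iff.rfl

theorem hilb_ne_zero (ψ : Hilb d n) (hψ : ‖ψ‖ = 1) : (⇑ψ : Config d n → ℂ) ≠ 0 := by
  intro h
  have := sum_norm_sq ψ hψ
  simp [h] at this

theorem isStabilizerState_of_wigner_nonneg (hd : Odd d) (ψ : Hilb d n) (hψ : ‖ψ‖ = 1)
    (hW : ∀ a, 0 ≤ wigner (pureState ψ) a) : IsStabilizerState ψ := by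
  have hcard := card_parity_eq_self hd ψ hψ hW
  have hψ0 := hilb_ne_zero ψ hψ
  have hne : Nonempty {a : Phase d n // parity a ψ = ψ} := by
    apply (Nat.card_pos_iff.1 _).1
    rw [hcard]
    exact pow_pos (NeZero.pos d) n
  obtain ⟨v, hv⟩ := hne
  refine ⟨hψ, fixedSubmodule hd v ψ hψ0, v, ⟨?_, ?_⟩, ?_⟩
  · intro a ha b hb
    exact symp_eq_zero_of_fixed hd hψ0 ha hb
  · rw [← hcard]
    have hiff : ∀ m : Phase d n, m ∈ fixedSubmodule hd v ψ hψ0 ↔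
        parity (v + (2 : ZMod d)⁻¹ • m) ψ = ψ := fun m => by
      rw [mem_fixedSubmodule, parity_add_half hd, hv]
    have h2 := two_mul_half hd
    refine Nat.card_congr
      { toFun := fun m => ⟨v + (2 : ZMod d)⁻¹ • (m : Phase d n), (hiff m).1 m.2⟩
        invFun := fun a => ⟨(2 : ZMod d) • ((a : Phase d n) - v), (hiff _).2 ?_⟩
        left_inv := fun m => ?_
        right_inv := fun a => ?_ }
    · rw [smul_smul, mul_comm, h2, one_smul, add_sub_cancel]
      exact a.2
    · ext1
      simp only [add_sub_cancel_left, smul_smul, h2, one_smul]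
    · ext1
      simp only [smul_smul, mul_comm _ (2 : ZMod d), h2, one_smul, add_sub_cancel]
  · intro m hm
    rw [weyl_mulVec]
    exact hm

theorem charFn_of_fixed (ψ : Hilb d n) (hψ : ‖ψ‖ = 1) {v m : Phase d n}
    (h : chi (symp v m) • weylAct m ψ = ψ) :
    charFn (pureState ψ) m = ((d : ℂ) ^ n)⁻¹ * chi (symp v m) := by
  have hs : ∑ x, ψ x * star (ψ x) = 1 := by
    simp_rw [Complex.star_def, Complex.mul_conj', ← Complex.ofReal_pow]
    rw [← Complex.ofReal_sum, sum_norm_sq ψ hψ, Complex.ofReal_one]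
  rw [charFn_eq, weylAct_eq_of_fixed h]
  congr 1
  rw [← mul_one (chi (symp v m)), ← hs, Finset.mul_sum]
  refine Finset.sum_congr rfl fun x _ => ?_
  rw [Pi.smul_apply, smul_eq_mul, star_mul', star_chi, neg_neg]
  ring

theorem wigner_nonneg_of_isStabilizerState (ψ : Hilb d n)
    (hstab : IsStabilizerState ψ) (a : Phase d n) : 0 ≤ wigner (pureState ψ) a := by
  classical
  obtain ⟨hψ, M, v, ⟨-, hcard⟩, hfix⟩ := hstab
  simp_rw [weyl_mulVec] at hfix
  have hpos := natCast_pow_pos (d := d) (n := n)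
  have hin : ∀ m ∈ M, charFn (pureState ψ) m = ((d : ℂ) ^ n)⁻¹ * chi (symp v m) :=
    fun m hm => charFn_of_fixed ψ hψ (hfix m hm)
  have hMsum : ∑ b with b ∈ M, ‖charFn (pureState ψ) b‖ ^ 2 = ((d : ℝ) ^ n)⁻¹ := by
    have : ∀ b ∈ Finset.univ.filter (· ∈ M),
        ‖charFn (pureState ψ) b‖ ^ 2 = ((d : ℝ) ^ n)⁻¹ ^ 2 := fun b hb => by
      rw [hin b (Finset.mem_filter.1 hb).2, norm_mul, norm_chi]
      simp
    rw [Finset.sum_congr rfl this, Finset.sum_const, nsmul_eq_mul, ← Fintype.card_subtype,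
      ← Nat.card_eq_fintype_card]
    have hc : Nat.card {x // x ∈ M} = d ^ n := hcard
    rw [hc]
    push_cast
    field_simp
  have hout : ∀ b, b ∉ M → charFn (pureState ψ) b = 0 := by
    have h := Finset.sum_filter_add_sum_filter_not Finset.univ (· ∈ M)
      fun b => ‖charFn (pureState ψ) b‖ ^ 2
    rw [hMsum, sum_norm_charFn_sq ψ hψ, add_eq_left,
      Finset.sum_eq_zero_iff_of_nonneg fun _ _ => sq_nonneg _] at h
    intro b hb
    have := h b (Finset.mem_filter.2 ⟨Finset.mem_univ b, hb⟩)
    rwa [sq_eq_zero_iff, norm_eq_zero] at this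
  have hW : wigner (pureState ψ) a =
      ((d : ℂ) ^ n)⁻¹ * (((d : ℂ) ^ n)⁻¹ * ∑ m : M, chi (symp (v + -a) m)) := by
    rw [wigner, sympFourier]
    congr 1
    rw [Finset.mul_sum, ← Finset.sum_subset (Finset.subset_univ (Finset.univ.filter (· ∈ M)))]
    · rw [Finset.sum_subtype (p := (· ∈ M)) _ fun b => by simp]
      refine Finset.sum_congr rfl fun m _ => ?_
      have e : symp (-a) m.1 = -symp a m.1 := by
        simp only [symp, Prod.fst_neg, Prod.snd_neg, neg_dotProduct]; ring
      rw [hin m m.2, star_chi, symp_add_left, chi_add, e]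
      ring
    · intro b _ hb
      rw [hout b fun h => hb (Finset.mem_filter.2 ⟨Finset.mem_univ b, h⟩), mul_zero]
  have hd0 : (0 : ℂ) ≤ ((d : ℂ) ^ n)⁻¹ := by
    rw [show ((d : ℂ) ^ n)⁻¹ = ((((d : ℝ) ^ n)⁻¹ : ℝ) : ℂ) by push_cast; rfl]
    exact Complex.zero_le_real.2 (inv_nonneg.2 hpos.le)
  rw [hW]
  refine mul_nonneg hd0 (mul_nonneg hd0 ?_)
  have h := sum_chi_hom (d := d) (G := M) ⟨⟨fun m => symp (v + -a) (m : Phase d n), by simp [symp]⟩,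
    fun x y => symp_add_right _ _ _⟩
  simp only [AddMonoidHom.coe_mk, ZeroHom.coe_mk] at h
  rw [h]
  split_ifs
  · exact Nat.cast_nonneg _
  · exact le_rfl

theorem isStabilizerState_of_quadratic (hd : Odd d) (ψ : Hilb d n) (hψ : ‖ψ‖ = 1)
    {θ : Matrix (Fin n) (Fin n) (ZMod d)} (hθ : θ.IsSymm) (x : Config d n) (c : ℂ)
    (h : ∀ q : Config d n, ψ q = c * chi (q ⬝ᵥ θ *ᵥ q + x ⬝ᵥ q)) : IsStabilizerState ψ := by
  have h2 := two_mul_half hd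
  let L : Config d n →ₗ[ZMod d] Phase d n := ((2 : ZMod d) • θ.mulVecLin).prod LinearMap.id
  have hL : ∀ q, L q = ((2 : ZMod d) • θ *ᵥ q, q) := fun q => rfl
  refine ⟨hψ, LinearMap.range L, (x, 0), ⟨?_, ?_⟩, ?_⟩
  · rintro _ ⟨p, rfl⟩ _ ⟨q, rfl⟩
    rw [hL, hL, symp]
    simp only [smul_dotProduct, dotProduct_smul]
    rw [dotProduct_comm, dotProduct_mulVec_comm hθ, sub_self]
  · have hinj : Function.Injective L := fun p q hpq => congrArg Prod.snd hpq
    rw [← Nat.card_congr (LinearEquiv.ofInjective L hinj).toEquiv]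
    simp
  · rintro _ ⟨q, rfl⟩
    rw [weyl_mulVec, hL]
    funext y
    rw [Pi.smul_apply, smul_eq_mul, weylAct, h, h, mul_left_comm (chi (_ - _)), mul_left_comm,
      ← chi_add, ← chi_add]
    congr 2
    simp only [symp, smul_dotProduct, dotProduct_sub, sub_dotProduct, Matrix.mulVec_sub,
      smul_eq_mul, zero_dotProduct]
    rw [dotProduct_mulVec_comm hθ y q, dotProduct_comm (θ *ᵥ q) y, dotProduct_comm (θ *ᵥ q) q,
      dotProduct_mulVec_comm hθ y q]
    linear_combination -(q ⬝ᵥ θ *ᵥ q) * h2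

theorem exists_quadratic_of_isStabilizerState (hd : Odd d) (ψ : Hilb d n)
    (hstab : IsStabilizerState ψ) (h0 : ∀ q, ψ q ≠ 0) :
    ∃ (θ : Matrix (Fin n) (Fin n) (ZMod d)) (x : Config d n) (c : ℂ), θ.IsSymm ∧ c ≠ 0 ∧
      ∀ q : Config d n, ψ q = c * chi (q ⬝ᵥ θ *ᵥ q + x ⬝ᵥ q) := by
  obtain ⟨-, M, v, ⟨hiso, hcard⟩, hfix⟩ := hstab
  simp_rw [weyl_mulVec] at hfix
  have h2 := two_mul_half hd
  let π : M →ₗ[ZMod d] Config d n := (LinearMap.snd _ _ _).comp M.subtype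
  have hker : Function.Injective π := by
    rw [← LinearMap.ker_eq_bot, LinearMap.ker_eq_bot']
    rintro ⟨⟨p, q⟩, hm⟩ (rfl : q = 0)
    have key : ∀ y : Config d n, symp v (p, 0) + p ⬝ᵥ y = 0 := by
      intro y
      have := congrFun (hfix _ hm) y
      simp only [Pi.smul_apply, smul_eq_mul, weylAct, ← mul_assoc, ← chi_add, sub_zero,
        dotProduct_zero, mul_zero] at this
      exact chi_eq_one_iff.1 (mul_right_cancel₀ (h0 y) (this.trans (one_mul _).symm))
    have hp : p = 0 := by
      funext i
      have h1 := key 0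
      have h2 := key (Pi.single i 1)
      rw [dotProduct_zero, add_zero] at h1
      rw [h1, zero_add] at h2
      simpa using h2
    subst hp
    rfl
  have hbij : Function.Bijective π := by
    rw [Nat.bijective_iff_injective_and_card]
    exact ⟨hker, by rw [hcard]; simp⟩
  let e := LinearEquiv.ofBijective π hbij
  let L : Config d n →ₗ[ZMod d] Config d n :=
    ((LinearMap.fst _ _ _).comp M.subtype).comp e.symm.toLinearMap
  have hL : ∀ q, (L q, q) ∈ M := by
    intro q
    have : (L q, q) = (e.symm q : Phase d n) :=
      Prod.ext rfl (e.apply_symm_apply q).symm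
    rw [this]
    exact (e.symm q).2
  have hsymm : ∀ p q, L p ⬝ᵥ q = p ⬝ᵥ L q := fun p q => sub_eq_zero.1 (hiso _ (hL p) _ (hL q))
  refine ⟨(2 : ZMod d)⁻¹ • LinearMap.toMatrix' L, v.1 - L v.2, ψ 0, ?_, h0 0, ?_⟩
  · refine Matrix.IsSymm.smul ?_ _
    ext i j
    have := hsymm (Pi.single i 1) (Pi.single j 1)
    simpa [LinearMap.toMatrix'_apply] using this
  · intro q
    have := congrFun (hfix _ (hL q)) q
    rw [← this, Pi.smul_apply, smul_eq_mul, weylAct, ← mul_assoc, ← chi_add, mul_comm, sub_self]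
    congr 2
    rw [Matrix.smul_mulVec, LinearMap.toMatrix'_mulVec, dotProduct_smul, sub_dotProduct, hsymm v.2]
    simp only [symp, smul_eq_mul]
    rw [dotProduct_comm (L q) q]
    linear_combination -(q ⬝ᵥ L q) * h2

end

end DiscreteHudson

theorem theorem2 (d n : ℕ) [NeZero d] (hd : Odd d) (ψ : DiscreteHudson.Hilb d n)
    (hψ : ‖ψ‖ = 1) :
    ((∀ a : DiscreteHudson.Phase d n,
        0 ≤ DiscreteHudson.wigner (DiscreteHudson.pureState ψ) a) ↔
      DiscreteHudson.IsStabilizerState ψ) ∧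
    ((∀ q : DiscreteHudson.Config d n, ψ q ≠ 0) →
      (DiscreteHudson.IsStabilizerState ψ ↔
        ∃ (θ : Matrix (Fin n) (Fin n) (ZMod d)) (x : DiscreteHudson.Config d n) (c : ℂ),
          θ.IsSymm ∧ c ≠ 0 ∧
          ∀ q : DiscreteHudson.Config d n,
            ψ q = c * DiscreteHudson.chi (q ⬝ᵥ θ *ᵥ q + x ⬝ᵥ q))) :=
  ⟨⟨DiscreteHudson.isStabilizerState_of_wigner_nonneg hd ψ hψ,
    DiscreteHudson.wigner_nonneg_of_isStabilizerState ψ⟩,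
   fun h0 => ⟨fun h => DiscreteHudson.exists_quadratic_of_isStabilizerState hd ψ h h0,
    fun ⟨_, x, c, hθ, _, h⟩ => DiscreteHudson.isStabilizerState_of_quadratic hd ψ hψ hθ x c h⟩⟩
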